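/- **Theorem.** A binary tree is either a single leaf, or an inner node together with an ordered pair of binary trees (its left and right subtree); its size is its number of inner nodes. The register function (Horton–Strahler number) of a binary tree is defined by $\operatorname{Reg}(t)=0$ if $t$ is a single leaf and, if $t$ has subtrees $t_1,t_2$, by $\operatorname{Reg}(t)=\max\{\operatorname{Reg}(t_1),\operatorname{Reg}(t_2)\}$ if $\operatorname{Reg}(t_1)\neq\operatorname{Reg}(t_2)$ and $\operatorname{Reg}(t)=\operatorname{Reg}(t_1)+1$ otherwise. Label each node of a binary tree (inner nodes as well as leaves) with the value of the register function of the subtree rooted at it. For $r\ge 0$, an $r$-branch of the tree is a maximal connected set of nodes labeled $r$ (which is necessarily a chain). Let $X_{n;r}$ be the number of $r$-branches in a binary tree chosen uniformly at random among all binary trees of size $n$. Let $r\in\mathbb{N}_0$ be fixed. Then, as $n\to\infty$, \begin{align*} \mathbb{E} X_{n;r} &= \frac{n}{4^{r}} + \frac{1}{6}\Big(1+\frac{5}{4^{r}}\Big) + \frac{1}{20n}\Big(4^{r}-\frac{1}{4^{r}}\Big) + \frac{1}{12n^{2}}\Big(\frac{5\cdot 16^{r}}{21}-\frac{7\cdot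 4^{r}}{10}+\frac{97}{210\cdot 4^{r}}\Big) + O(n^{-3}),\\ \mathbb{V} X_{n;r} &= \frac{4^{r}-1}{3\cdot 16^{r}}\,n - \frac{2\cdot 16^{r}-25\cdot 4^{r}+23}{90\cdot 16^{r}} - \frac{13\cdot 64^{r}-14\cdot 16^{r}+7\cdot 4^{r}-6}{420\cdot 16^{r}\,n} + O(n^{-2}), \end{align*} where the constants implied by the $O$-terms may depend on $r$. -/

import Mathlib

namespace RBranches

/-!
A binary tree is a term of `BinaryTree Unit`: `BinaryTree.nil` is the tree consisting of a single leaf, and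
`BinaryTree.node () t₁ t₂` is an inner node with left subtree `t₁` and right subtree `t₂`. The size of a
tree is its number of inner nodes, `BinaryTree.numNodes`. The leaves (every occurrence of `BinaryTree.nil`)
are nodes of the tree as well.
-/

/-- The register function (Horton–Strahler number) of a binary tree. -/
def reg : BinaryTree Unit → ℕ
  | BinaryTree.nil => 0
  | BinaryTree.node _ t₁ t₂ => if reg t₁ = reg t₂ then reg t₁ + 1 else max (reg t₁) (reg t₂)

/-- The subtree of `t` rooted at the node with address `p`, if there is such a node. The address
of a node (inner node or leaf) is the sequence of turns on the way from the root to it,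
`false` for left and `true` for right. -/
def subtreeAt : BinaryTree Unit → List Bool → Option (BinaryTree Unit)
  | t, [] => some t
  | BinaryTree.nil, _ :: _ => none
  | BinaryTree.node _ t₁ _, false :: p => subtreeAt t₁ p
  | BinaryTree.node _ _ t₂, true :: p => subtreeAt t₂ p

/-- The nodes (inner nodes and leaves) of `t` labeled `r`; the label of a node is the value of the
register function of the subtree rooted at it. -/
def nodesLabeled (t : BinaryTree Unit) (r : ℕ) : Set (List Bool) :=
  {p | ∃ s, subtreeAt t p = some s ∧ reg s = r}

/-- The parent–child adjacency of addresses; restricted to the nodes of a binary tree, this is the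
tree as a graph. -/
def addressGraph : SimpleGraph (List Bool) :=
  SimpleGraph.fromRel fun p q => ∃ b, q = p ++ [b]

/-- The `r`-branches of `t`: the maximal connected sets (chains) of nodes labeled `r`, i.e. the
connected components of the subgraph of `t` induced by the nodes labeled `r`. -/
abbrev Branch (t : BinaryTree Unit) (r : ℕ) : Type :=
  (addressGraph.induce (nodesLabeled t r)).ConnectedComponent

/-- The number of `r`-branches of `t`. -/
noncomputable def numBranches (r : ℕ) (t : BinaryTree Unit) : ℕ := Nat.card (Branch t r)

/-- The expected value of `X t` for `t` uniformly random among the binary trees of size `n`. -/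
noncomputable def expectation (n : ℕ) (X : BinaryTree Unit → ℝ) : ℝ :=
  (∑ t ∈ BinaryTree.treesOfNumNodesEq n, X t) / ((BinaryTree.treesOfNumNodesEq n).card : ℝ)

/-- The variance of `X t` for `t` uniformly random among the binary trees of size `n`. -/
noncomputable def variance (n : ℕ) (X : BinaryTree Unit → ℝ) : ℝ :=
  expectation n fun t => (X t - expectation n X) ^ 2

end RBranches

open scoped Asymptotics

/-!
Every connected component of the set of nodes labeled `r` has a unique node closest to the root.
Hence the number of `r`-branches is additive over the two subtrees of a tree, except that the root
starts a new branch when both subtrees have register function `r - 1`. If `F` and `G` are the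
generating functions of the total number of `r`-branches and of its second factorial moment, this
says `X F = (1 - 4 X) ^ (-1/2) V r` and `X G = 2 (1 - 4 X) ^ (-3/2) (V r) ^ 2`, where `V 0 = X` and
`V (r + 1) * (1 - 4 X + 4 V r) = (V r) ^ 2`.

The series `1 - 4 X + 4 V r` is a square `(L r) ^ 2`. Half-angle formulas write `L r` as a quotient
of products of linear factors `1 - a X` with `|a| < 4`, so the coefficients of `1 / L r`, and with
them those of `V r`, are summable against `n ^ k / 4 ^ n` for every `k`. Inductively, `V r` is then
a polynomial in `ε = 1 - 4 X` up to `ε ^ 4` times such a series, and multiplying `ε ^ α` by such a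
series does not increase the order of magnitude of its coefficients. This reduces both moments to
the coefficients of half-integer powers of `1 - 4 X`, and dividing by those of `√(1 - 4 X)`, which
count the trees, leaves rational functions of `n`.
-/

namespace RBranches

open BinaryTree

/-- The elements of a set of addresses whose parent is not in the set. The connected components of
the set correspond to them, which turns counting branches into counting nodes. -/
def topNodes (S : Set (List Bool)) : Set (List Bool) :=
  {p | p ∈ S ∧ ∀ q b, p = q ++ [b] → q ∉ S}

open Classical in
/-- The address at which one ends up when climbing from `p` towards the root as long as the parent
lies in `S`. -/
noncomputable def topNode (S : Set (List Bool)) (p : List Bool) : List Bool :=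
  p.reverseRecOn [] fun q b top => if q ∈ S then top else q ++ [b]

theorem topNode_nil (S : Set (List Bool)) : topNode S [] = [] := by
  rw [topNode, List.reverseRecOn_nil]

theorem topNode_concat_of_mem {S : Set (List Bool)} {p : List Bool} (hp : p ∈ S) (b : Bool) :
    topNode S (p ++ [b]) = topNode S p := by
  rw [topNode, List.reverseRecOn_concat, if_pos hp, topNode]

theorem topNode_concat_of_notMem {S : Set (List Bool)} {p : List Bool} (hp : p ∉ S) (b : Bool) :
    topNode S (p ++ [b]) = p ++ [b] := by
  rw [topNode, List.reverseRecOn_concat, if_neg hp]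

theorem topNode_mem_topNodes {S : Set (List Bool)} {p : List Bool} (hp : p ∈ S) :
    topNode S p ∈ topNodes S := by
  induction p using List.reverseRecOn with
  | nil => exact ⟨by rwa [topNode_nil], by simp [topNode_nil]⟩
  | append_singleton q b ih =>
    by_cases hq : q ∈ S
    · rw [topNode_concat_of_mem hq]
      exact ih hq
    · rw [topNode_concat_of_notMem hq]
      refine ⟨hp, fun q' b' h => ?_⟩
      obtain ⟨rfl, -⟩ := List.append_inj' h rfl
      exact hq

theorem topNode_of_mem_topNodes {S : Set (List Bool)} {p : List Bool} (hp : p ∈ topNodes S) :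
    topNode S p = p := by
  rcases List.eq_nil_or_concat p with rfl | ⟨q, b, rfl⟩
  · exact topNode_nil S
  · rw [List.concat_eq_append] at hp ⊢
    exact topNode_concat_of_notMem (hp.2 q b rfl) b

theorem addressGraph_adj {p q : List Bool} :
    addressGraph.Adj p q ↔ (∃ b, q = p ++ [b]) ∨ ∃ b, p = q ++ [b] := by
  rw [addressGraph, SimpleGraph.fromRel_adj]
  refine ⟨fun h => h.2, fun h => ⟨?_, h⟩⟩
  rintro rfl
  rcases h with ⟨b, hb⟩ | ⟨b, hb⟩ <;> simpa using congrArg List.length hb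

theorem topNode_eq_of_adj {S : Set (List Bool)} {p q : S} (h : (addressGraph.induce S).Adj p q) :
    topNode S p = topNode S q := by
  have h : addressGraph.Adj (p : List Bool) q := h
  obtain ⟨b, hb⟩ | ⟨b, hb⟩ := addressGraph_adj.1 h
  · rw [hb, topNode_concat_of_mem p.2]
  · rw [hb, topNode_concat_of_mem q.2]

theorem topNode_eq_of_reachable {S : Set (List Bool)} {p q : S}
    (h : (addressGraph.induce S).Reachable p q) : topNode S p = topNode S q := by
  obtain ⟨w⟩ := h
  induction w with
  | nil => rfl
  | cons hadj _ ih => exact (topNode_eq_of_adj hadj).trans ih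

theorem reachable_topNode {S : Set (List Bool)} {p : List Bool} (hp : p ∈ S) :
    (addressGraph.induce S).Reachable ⟨topNode S p, (topNode_mem_topNodes hp).1⟩ ⟨p, hp⟩ := by
  induction p using List.reverseRecOn with
  | nil => simp only [topNode_nil, SimpleGraph.Reachable.refl]
  | append_singleton q b ih =>
    by_cases hq : q ∈ S
    · simp only [topNode_concat_of_mem hq]
      exact (ih hq).trans (SimpleGraph.Adj.reachable (addressGraph_adj.2 (Or.inl ⟨b, rfl⟩)))
    · simp only [topNode_concat_of_notMem hq, SimpleGraph.Reachable.refl]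

/-- A connected component of a set of addresses corresponds to its node closest to the root. -/
noncomputable def connectedComponentEquivTopNodes (S : Set (List Bool)) :
    (addressGraph.induce S).ConnectedComponent ≃ topNodes S where
  toFun := SimpleGraph.ConnectedComponent.lift
    (fun p => ⟨topNode S p, topNode_mem_topNodes p.2⟩)
    fun _ _ w _ => Subtype.ext (topNode_eq_of_reachable w.reachable)
  invFun p := (addressGraph.induce S).connectedComponentMk ⟨p, p.2.1⟩
  left_inv c := by
    induction c using SimpleGraph.ConnectedComponent.ind with
    | h p => exact SimpleGraph.ConnectedComponent.sound (reachable_topNode p.2)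
  right_inv p := Subtype.ext (topNode_of_mem_topNodes p.2)

theorem numBranches_eq_ncard_topNodes (r : ℕ) (t : BinaryTree Unit) :
    numBranches r t = (topNodes (nodesLabeled t r)).ncard :=
  Nat.card_congr (connectedComponentEquivTopNodes _)

theorem eq_union_image_cons (A : Set (List Bool)) :
    A = (A ∩ {[]}) ∪ List.cons false '' (List.cons false ⁻¹' A) ∪
      List.cons true '' (List.cons true ⁻¹' A) := by
  ext p
  rcases p with _ | ⟨_ | _, p⟩ <;> simp

theorem finite_of_finite_preimage_cons {A : Set (List Bool)}
    (h : ∀ x, (List.cons x ⁻¹' A).Finite) : A.Finite := by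
  rw [eq_union_image_cons A]
  exact (((Set.finite_singleton _).inter_of_right _).union ((h false).image _)).union
    ((h true).image _)

theorem ncard_eq_add_ncard_preimage_cons {A : Set (List Bool)} (hA : A.Finite)
    [Decidable ([] ∈ A)] :
    A.ncard = (if [] ∈ A then 1 else 0) + (List.cons false ⁻¹' A).ncard +
      (List.cons true ⁻¹' A).ncard := by
  have h_image (x : Bool) : (List.cons x '' (List.cons x ⁻¹' A)).ncard =
      (List.cons x ⁻¹' A).ncard := Set.ncard_image_of_injective _ List.cons_injective
  have h_finite (x : Bool) : (List.cons x '' (List.cons x ⁻¹' A)).Finite :=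
    hA.subset (Set.image_preimage_subset _ _)
  have h_root : (A ∩ {[]}).ncard = if [] ∈ A then 1 else 0 := by
    split_ifs with h <;> simp [h]
  conv_lhs => rw [eq_union_image_cons A]
  rw [Set.ncard_union_eq _ ((hA.inter_of_left _).union (h_finite _)) (h_finite _),
    Set.ncard_union_eq _ (hA.inter_of_left _) (h_finite _), h_root, h_image, h_image]
  all_goals
    rw [Set.disjoint_left]
    aesop

theorem nil_mem_topNodes {S : Set (List Bool)} : [] ∈ topNodes S ↔ [] ∈ S := by
  simp [topNodes]

theorem cons_mem_topNodes {S : Set (List Bool)} {x : Bool} {p : List Bool} :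
    x :: p ∈ topNodes S ↔ p ∈ topNodes (List.cons x ⁻¹' S) ∧ (p = [] → [] ∉ S) := by
  refine ⟨fun h => ⟨⟨h.1, fun q b hq => h.2 (x :: q) b (by rw [hq, List.cons_append])⟩,
    fun hp => h.2 [] x (by rw [hp, List.nil_append])⟩, fun h => ⟨h.1.1, fun q b hq => ?_⟩⟩
  rcases q with _ | ⟨y, q⟩
  · exact h.2 (List.cons.inj hq).2
  · rw [List.cons_append, List.cons.injEq] at hq
    obtain ⟨rfl, hq⟩ := hq
    exact h.1.2 q b hq

theorem ncard_preimage_cons_topNodes {S : Set (List Bool)} (hS : S.Finite) (x : Bool)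
    [Decidable ([] ∈ S)] [Decidable ([x] ∈ S)] :
    (List.cons x ⁻¹' topNodes S).ncard + (if [] ∈ S ∧ [x] ∈ S then 1 else 0) =
      (topNodes (List.cons x ⁻¹' S)).ncard := by
  have h_finite : (topNodes (List.cons x ⁻¹' S)).Finite :=
    (hS.preimage List.cons_injective.injOn).subset fun _ hp => hp.1
  split_ifs with h
  · have h_preimage : List.cons x ⁻¹' topNodes S = topNodes (List.cons x ⁻¹' S) \ {[]} := by
      ext p
      simp [cons_mem_topNodes, h.1]
    rw [h_preimage, Set.ncard_sdiff_singleton_add_one (nil_mem_topNodes.2 h.2) h_finite]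
  · have h_preimage : List.cons x ⁻¹' topNodes S = topNodes (List.cons x ⁻¹' S) := by
      ext p
      refine cons_mem_topNodes.trans (and_iff_left_of_imp ?_)
      rintro hp rfl hroot
      exact h ⟨hroot, hp.1⟩
    rw [h_preimage, add_zero]

theorem ncard_topNodes_add {S : Set (List Bool)} (hS : S.Finite) [DecidablePred (· ∈ S)] :
    (topNodes S).ncard + ((if [] ∈ S ∧ [false] ∈ S then 1 else 0) +
        if [] ∈ S ∧ [true] ∈ S then 1 else 0) =
      (if [] ∈ S then 1 else 0) + (topNodes (List.cons false ⁻¹' S)).ncard +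
        (topNodes (List.cons true ⁻¹' S)).ncard := by
  classical
  rw [ncard_eq_add_ncard_preimage_cons (hS.subset fun p hp => hp.1 : (topNodes S).Finite),
    ← ncard_preimage_cons_topNodes hS false, ← ncard_preimage_cons_topNodes hS true]
  simp only [nil_mem_topNodes]
  ring

theorem nil_mem_nodesLabeled {t : BinaryTree Unit} {r : ℕ} :
    [] ∈ nodesLabeled t r ↔ reg t = r := by
  cases t <;> simp [nodesLabeled, subtreeAt]

theorem nodesLabeled_nil (r : ℕ) : nodesLabeled nil r = {p | p = [] ∧ r = 0} := by
  ext p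
  cases p <;> simp [nodesLabeled, subtreeAt, reg, eq_comm]

theorem preimage_cons_nodesLabeled_node (x : Bool) (a b : BinaryTree Unit) (r : ℕ) :
    List.cons x ⁻¹' nodesLabeled (node () a b) r = nodesLabeled (cond x b a) r := by
  ext p
  cases x <;> simp [nodesLabeled, subtreeAt]

theorem finite_nodesLabeled (t : BinaryTree Unit) (r : ℕ) : (nodesLabeled t r).Finite := by
  induction t using BinaryTree.unitRecOn with
  | base =>
    rw [nodesLabeled_nil]
    exact (Set.finite_singleton []).subset fun p hp => hp.1
  | ind a b iha ihb =>
    refine finite_of_finite_preimage_cons fun x => ?_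
    rw [preimage_cons_nodesLabeled_node]
    cases x <;> assumption

theorem numBranches_nil (r : ℕ) : numBranches r nil = if r = 0 then 1 else 0 := by
  have h_top : topNodes (nodesLabeled nil r) = {p | p = [] ∧ r = 0} := by
    ext p
    cases p <;> simp +contextual [topNodes, nodesLabeled_nil]
  rw [numBranches_eq_ncard_topNodes, h_top]
  split_ifs with h <;> simp [h]

theorem numBranches_node (r : ℕ) (a b : BinaryTree Unit) :
    numBranches r (node () a b) = numBranches r a + numBranches r b +
      if reg a = reg b ∧ reg a + 1 = r then 1 else 0 := by
  classical
  have h_mem (x : Bool) : [x] ∈ nodesLabeled (node () a b) r ↔ reg (cond x b a) = r := by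
    rw [← nil_mem_nodesLabeled, ← preimage_cons_nodesLabeled_node, Set.mem_preimage]
  have h_count := ncard_topNodes_add (finite_nodesLabeled (node () a b) r)
  simp only [h_mem, nil_mem_nodesLabeled, preimage_cons_nodesLabeled_node, cond_true, cond_false,
    ← numBranches_eq_ncard_topNodes, reg] at h_count
  split_ifs at h_count ⊢ <;> omega

theorem numBranches_eq_zero {r : ℕ} {t : BinaryTree Unit} (h : reg t < r) :
    numBranches r t = 0 := by
  induction t using BinaryTree.unitRecOn with
  | base => rw [numBranches_nil, if_neg (by omega)]
  | ind a b iha ihb =>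
    rw [reg] at h
    rw [numBranches_node]
    split_ifs at h ⊢ <;> omega

section GeneratingFunctions

open PowerSeries Finset

variable {R : Type*} [CommRing R]

/-- The generating function of a tree statistic, by the number of inner nodes. -/
noncomputable def treeSeries : (BinaryTree Unit → R) →ₗ[R] R⟦X⟧ where
  toFun f := PowerSeries.mk fun n => ∑ t ∈ treesOfNumNodesEq n, f t
  map_add' f g := by ext; simp [sum_add_distrib]
  map_smul' c f := by ext; simp [mul_sum]

/-- The generating function of a statistic of ordered pairs of trees, by the total number of inner
nodes. -/
noncomputable def pairSeries : (BinaryTree Unit → BinaryTree Unit → R) →ₗ[R] R⟦X⟧ where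
  toFun f := PowerSeries.mk fun n => ∑ ij ∈ antidiagonal n,
    ∑ a ∈ treesOfNumNodesEq ij.1, ∑ b ∈ treesOfNumNodesEq ij.2, f a b
  map_add' f g := by ext; simp [sum_add_distrib]
  map_smul' c f := by ext; simp [mul_sum]

theorem coeff_treeSeries (f : BinaryTree Unit → R) (n : ℕ) :
    coeff n (treeSeries f) = ∑ t ∈ treesOfNumNodesEq n, f t := by
  simp [treeSeries]

theorem coeff_pairSeries (f : BinaryTree Unit → BinaryTree Unit → R) (n : ℕ) :
    coeff n (pairSeries f) = ∑ ij ∈ antidiagonal n,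
      ∑ a ∈ treesOfNumNodesEq ij.1, ∑ b ∈ treesOfNumNodesEq ij.2, f a b := by
  simp [pairSeries]

theorem sum_treesOfNumNodesEq_succ {M : Type*} [AddCommMonoid M] (f : BinaryTree Unit → M)
    (n : ℕ) : ∑ t ∈ treesOfNumNodesEq (n + 1), f t = ∑ ij ∈ antidiagonal n,
      ∑ a ∈ treesOfNumNodesEq ij.1, ∑ b ∈ treesOfNumNodesEq ij.2, f (node () a b) := by
  rw [treesOfNumNodesEq_succ, sum_biUnion]
  · exact sum_congr rfl fun ij _ => by rw [sum_map, sum_product]; rfl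
  · simp_rw [Set.PairwiseDisjoint, Set.Pairwise, disjoint_left]
    aesop

theorem treeSeries_eq (f : BinaryTree Unit → R) :
    treeSeries f = C (f nil) + X * pairSeries fun a b => f (node () a b) := by
  ext n
  cases n with
  | zero => simp [coeff_treeSeries]
  | succ n =>
    rw [map_add, coeff_succ_X_mul, coeff_C, if_neg n.succ_ne_zero, zero_add, coeff_treeSeries,
      coeff_pairSeries, sum_treesOfNumNodesEq_succ]

theorem pairSeries_mul (f g : BinaryTree Unit → R) :
    pairSeries (fun a b => f a * g b) = treeSeries f * treeSeries g := by
  ext n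
  simp only [coeff_mul, coeff_pairSeries, coeff_treeSeries, sum_mul_sum]

theorem treeSeries_mul_of_node_eq_add {f : BinaryTree Unit → R}
    {toll : BinaryTree Unit → BinaryTree Unit → R}
    (h : ∀ a b, f (node () a b) = f a + f b + toll a b) :
    treeSeries f * (1 - 2 * X * treeSeries 1) = C (f nil) + X * pairSeries toll := by
  have h_pair : pairSeries (fun a b => f (node () a b)) =
      2 * treeSeries f * treeSeries 1 + pairSeries toll := by
    have h_split : (fun a b => f (node () a b)) =
        (fun a b => f a * (1 : BinaryTree Unit → R) b) +
          (fun a b => (1 : BinaryTree Unit → R) a * f b) + toll := by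
      ext a b
      simp [h]
    rw [h_split, map_add, map_add, pairSeries_mul, pairSeries_mul]
    ring
  linear_combination treeSeries_eq f + X * h_pair

variable (R)

theorem one_sub_treeSeries_one_sq :
    (1 - 2 * X * treeSeries (1 : BinaryTree Unit → R)) ^ 2 = 1 - 4 * X := by
  have h_catalan : treeSeries (1 : BinaryTree Unit → R) = 1 + X * treeSeries 1 ^ 2 := by
    have h_pair := pairSeries_mul (1 : BinaryTree Unit → R) 1
    simp only [Pi.one_apply, mul_one] at h_pair
    simpa only [Pi.one_apply, map_one, h_pair, ← sq] using treeSeries_eq (1 : BinaryTree Unit → R)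
  linear_combination (-4 * X) * h_catalan

/-- The indicator of the trees with register function `k`. -/
def regIndicator (k : ℕ) (t : BinaryTree Unit) : R := if reg t = k then 1 else 0

/-- `X` times the generating function of the trees with register function `k`, that is, their
generating function by the number of leaves. -/
noncomputable def regSeries (k : ℕ) : R⟦X⟧ := X * treeSeries (regIndicator R k)

/-- The series `1 - 2 X S`, where `S` is the generating function of the trees with register function
less than `k`; it tends to `√(1 - 4 X)` as `k` grows. -/
noncomputable def lowRegSeries (k : ℕ) : R⟦X⟧ := 1 - 2 * ∑ j ∈ range k, regSeries R j

/-- The series `V r` for which `V r / (X √(1 - 4 X))` is the generating function of the total number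
of `r`-branches. -/
noncomputable def branchNumerator (r : ℕ) : R⟦X⟧ := lowRegSeries R r * regSeries R r

theorem regSeries_zero : regSeries R 0 = X := by
  have h_node : (fun a b => regIndicator R 0 (node () a b)) = 0 := by
    ext a b
    rw [regIndicator, reg, if_neg (by split_ifs <;> grind)]
    rfl
  rw [regSeries, treeSeries_eq, h_node, map_zero]
  simp [regIndicator, reg]

theorem regIndicator_succ_node (k : ℕ) (a b : BinaryTree Unit) :
    regIndicator R (k + 1) (node () a b) = regIndicator R k a * regIndicator R k b +
      regIndicator R (k + 1) a * (∑ j ∈ range (k + 1), regIndicator R j) b +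
      (∑ j ∈ range (k + 1), regIndicator R j) a * regIndicator R (k + 1) b := by
  simp only [regIndicator, Finset.sum_apply, sum_ite_eq, mem_range, reg]
  split_ifs <;> first | omega | simp

theorem regSeries_succ_mul (k : ℕ) :
    regSeries R (k + 1) * lowRegSeries R (k + 1) = regSeries R k ^ 2 := by
  have h_node : (fun a b => regIndicator R (k + 1) (node () a b)) =
      (fun a b => regIndicator R k a * regIndicator R k b) +
        (fun a b => regIndicator R (k + 1) a * (∑ j ∈ range (k + 1), regIndicator R j) b) +
        fun a b => (∑ j ∈ range (k + 1), regIndicator R j) a * regIndicator R (k + 1) b := by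
    ext a b
    exact regIndicator_succ_node R k a b
  have h_tree := treeSeries_eq (regIndicator R (k + 1))
  rw [h_node, map_add, map_add, pairSeries_mul, pairSeries_mul, pairSeries_mul, map_sum,
    show regIndicator R (k + 1) nil = 0 by simp [regIndicator, reg], map_zero] at h_tree
  simp only [lowRegSeries, regSeries, ← mul_sum]
  linear_combination X * h_tree

theorem lowRegSeries_zero : lowRegSeries R 0 = 1 := by
  rw [lowRegSeries, sum_range_zero, mul_zero, sub_zero]

theorem lowRegSeries_succ (k : ℕ) :
    lowRegSeries R (k + 1) = lowRegSeries R k - 2 * regSeries R k := by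
  rw [lowRegSeries, lowRegSeries, sum_range_succ]
  ring

theorem branchNumerator_zero : branchNumerator R 0 = X := by
  rw [branchNumerator, lowRegSeries_zero, regSeries_zero, one_mul]

theorem branchNumerator_succ (r : ℕ) : branchNumerator R (r + 1) = regSeries R r ^ 2 := by
  rw [branchNumerator, mul_comm, regSeries_succ_mul]

theorem lowRegSeries_sq (k : ℕ) :
    lowRegSeries R k ^ 2 = (1 - 4 * X) + 4 * branchNumerator R k := by
  induction k with
  | zero =>
    rw [lowRegSeries_zero, branchNumerator_zero]
    ring
  | succ k ih =>
    rw [branchNumerator] at ih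
    rw [lowRegSeries_succ, branchNumerator_succ]
    linear_combination ih

theorem branchNumerator_succ_mul (r : ℕ) :
    branchNumerator R (r + 1) * lowRegSeries R r ^ 2 = branchNumerator R r ^ 2 := by
  rw [branchNumerator_succ, branchNumerator]
  ring

theorem treeSeries_numBranches_mul (r : ℕ) :
    X * treeSeries (fun t => (numBranches r t : R)) *
      (1 - 2 * X * treeSeries (1 : BinaryTree Unit → R)) = branchNumerator R r := by
  cases r with
  | zero =>
    rw [mul_assoc, treeSeries_mul_of_node_eq_add (toll := 0)
      (fun a b => by simp [numBranches_node]), map_zero, numBranches_nil, branchNumerator_zero]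
    simp
  | succ r =>
    have h_toll (a b : BinaryTree Unit) : (numBranches (r + 1) (node () a b) : R) =
        numBranches (r + 1) a + numBranches (r + 1) b +
          regIndicator R r a * regIndicator R r b := by
      rw [numBranches_node, regIndicator, regIndicator]
      push_cast
      split_ifs <;> first | omega | simp
    rw [mul_assoc, treeSeries_mul_of_node_eq_add h_toll, pairSeries_mul, numBranches_nil,
      branchNumerator_succ, regSeries]
    simp only [Nat.succ_ne_zero, if_false, Nat.cast_zero, map_zero]
    ring

theorem treeSeries_numBranches_mul_sub_one_mul (r : ℕ) :
    treeSeries (fun t => (numBranches r t * (numBranches r t - 1) : R)) *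
      (1 - 2 * X * treeSeries (1 : BinaryTree Unit → R)) =
      2 * X * treeSeries (fun t => (numBranches r t : R)) ^ 2 := by
  have h_nil : (numBranches r nil * (numBranches r nil - 1) : R) = 0 := by
    rw [numBranches_nil]
    split_ifs <;> simp
  have h_toll (a b : BinaryTree Unit) :
      (numBranches r (node () a b) * (numBranches r (node () a b) - 1) : R) =
        numBranches r a * (numBranches r a - 1) + numBranches r b * (numBranches r b - 1) +
          (2 : R) • (numBranches r a * numBranches r b) := by
    rw [numBranches_node]
    split_ifs with h
    · rw [numBranches_eq_zero (show reg a < r by omega),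
        numBranches_eq_zero (show reg b < r by omega)]
      simp
    · push_cast
      rw [smul_eq_mul]
      ring
  have h_pair : pairSeries (fun a b => (2 : R) • (numBranches r a * numBranches r b : R)) =
      2 * treeSeries (fun t => (numBranches r t : R)) ^ 2 := by
    rw [sq, ← pairSeries_mul, ← map_ofNat C 2, ← smul_eq_C_mul, ← map_smul]
    rfl
  rw [treeSeries_mul_of_node_eq_add h_toll, h_nil, h_pair, map_zero]
  ring

end GeneratingFunctions

section WeightedAlgebra

open PowerSeries Finset
open scoped NNReal

theorem polynomialWeight_add_le (k : ℕ) (ρ : ℝ≥0) (i j : ℕ) :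
    ((i + j : ℕ) + 1 : ℝ) ^ k * (ρ : ℝ) ^ (i + j) ≤
      (i + 1) ^ k * (ρ : ℝ) ^ i * ((j + 1) ^ k * (ρ : ℝ) ^ j) := by
  rw [mul_mul_mul_comm, ← mul_pow, ← pow_add]
  gcongr
  push_cast
  nlinarith [mul_nonneg (Nat.cast_nonneg (α := ℝ) i) (Nat.cast_nonneg (α := ℝ) j)]

/-- The algebra of the power series `f` for which `∑ ‖fₙ‖ (n + 1) ^ k ρ ^ n` is finite. It plays the
role of the functions that are smooth enough up to the circle of convergence of radius `ρ`. -/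
def weightedAlgebra (R : Type*) [NormedCommRing R] (k : ℕ) (ρ : ℝ≥0) : Subalgebra R R⟦X⟧ where
  carrier := {f | Summable fun n : ℕ => ‖coeff n f‖ * (((n : ℝ) + 1) ^ k * ρ ^ n)}
  mul_mem' {f g} hf hg := by
    refine Summable.of_nonneg_of_le (fun n => by positivity) (fun n => ?_)
      (summable_sum_mul_antidiagonal_of_summable_mul
        (Summable.mul_of_nonneg hf hg (fun n => by positivity) (fun n => by positivity)))
    rw [coeff_mul]
    grw [norm_sum_le, sum_mul]
    refine sum_le_sum fun ⟨i, j⟩ hij => ?_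
    obtain rfl := mem_antidiagonal.1 hij
    grw [norm_mul_le, polynomialWeight_add_le]
    exact (mul_mul_mul_comm _ _ _ _).le
  add_mem' {f g} hf hg := by
    refine Summable.of_nonneg_of_le (fun n => by positivity) (fun n => ?_) (Summable.add hf hg)
    rw [← add_mul, map_add]
    grw [norm_add_le]
  algebraMap_mem' c := summable_of_ne_finset_zero (s := {0}) fun n hn => by
    rw [algebraMap_eq, coeff_C, if_neg (by simpa using hn), norm_zero, zero_mul]

theorem mem_weightedAlgebra {R : Type*} [NormedCommRing R] {k : ℕ} {ρ : ℝ≥0} {f : R⟦X⟧} :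
    f ∈ weightedAlgebra R k ρ ↔ Summable fun n : ℕ => ‖coeff n f‖ * (((n : ℝ) + 1) ^ k * ρ ^ n) :=
  Iff.rfl

theorem X_mem_weightedAlgebra {R : Type*} [NormedCommRing R] {k : ℕ} {ρ : ℝ≥0} :
    X ∈ weightedAlgebra R k ρ :=
  summable_of_ne_finset_zero (s := {1}) fun n hn => by
    rw [coeff_X, if_neg (by simpa using hn), norm_zero, zero_mul]

theorem summable_add_one_pow_mul_geometric (k : ℕ) {x : ℝ} (hx : ‖x‖ < 1) :
    Summable fun n : ℕ => ((n : ℝ) + 1) ^ k * x ^ n := by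
  simp only [add_pow, one_pow, mul_one, sum_mul, mul_right_comm _ _ (x ^ _)]
  exact summable_sum fun i _ => (summable_pow_mul_geometric_of_norm_lt_one i hx).mul_right _

theorem inv_one_sub_C_mul_X {K : Type*} [Field K] (a : K) :
    (1 - C a * X)⁻¹ = PowerSeries.mk fun n => a ^ n := by
  rw [PowerSeries.inv_eq_iff_mul_eq_one (by simp)]
  simpa [rescale_X, rescale_mk] using congrArg (rescale a) (mk_one_mul_one_sub_eq_one K)

theorem inv_one_sub_C_mul_X_mem_weightedAlgebra {K : Type*} [NormedField K] (k : ℕ) {ρ : ℝ≥0}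
    {a : K} (ha : ‖a‖ * ρ < 1) : (1 - C a * X)⁻¹ ∈ weightedAlgebra K k ρ := by
  rw [inv_one_sub_C_mul_X, mem_weightedAlgebra]
  refine (summable_add_one_pow_mul_geometric k (x := ‖a‖ * ρ) ?_).congr fun n => ?_
  · rwa [Real.norm_of_nonneg (by positivity)]
  · rw [coeff_mk, norm_pow]
    ring

end WeightedAlgebra

section Regularity

open PowerSeries
open scoped NNReal

theorem constantCoeff_regSeries (R : Type*) [CommRing R] (j : ℕ) :
    constantCoeff (regSeries R j) = 0 := by
  simp [regSeries]

theorem constantCoeff_lowRegSeries (R : Type*) [CommRing R] (j : ℕ) :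
    constantCoeff (lowRegSeries R j) = 1 := by
  simp [lowRegSeries, constantCoeff_regSeries]

/-- For `c = 2 cos θ` and `d = 2 cos (θ / 2)` the hypothesis is the half-angle formula. Iterating
the factorization leads to the factors `1 - (2 + c) X` at level `0`, where `|2 + c| < 4`. -/
theorem lowRegSeries_sub_mul_lowRegSeries {R : Type*} [CommRing R] {c d : R} (h : d ^ 2 = 2 + c)
    (j : ℕ) :
    (lowRegSeries R (j + 2) - C c * regSeries R (j + 1)) * lowRegSeries R (j + 1) =
      (lowRegSeries R (j + 1) - C d * regSeries R j) *
        (lowRegSeries R (j + 1) - C (-d) * regSeries R j) := by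
  have hC : (C d : R⟦X⟧) ^ 2 = 2 + C c := by rw [← map_pow, h, map_add, map_ofNat]
  rw [map_neg, lowRegSeries_succ R (j + 1)]
  linear_combination (-(2 + C c)) * regSeries_succ_mul R j + regSeries R j ^ 2 * hC

theorem inv_lowRegSeries_sub {K : Type*} [Field K] {c d : K} (h : d ^ 2 = 2 + c) (j : ℕ) :
    (lowRegSeries K (j + 2) - C c * regSeries K (j + 1))⁻¹ = lowRegSeries K (j + 1) *
      ((lowRegSeries K (j + 1) - C d * regSeries K j)⁻¹ *
        (lowRegSeries K (j + 1) - C (-d) * regSeries K j)⁻¹) := by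
  have h_ne : constantCoeff (lowRegSeries K (j + 1)) ≠ 0 := by
    simp [constantCoeff_lowRegSeries]
  rw [mul_comm (_⁻¹) (_⁻¹), ← PowerSeries.mul_inv_rev, ← lowRegSeries_sub_mul_lowRegSeries h,
    PowerSeries.mul_inv_rev, ← mul_assoc, PowerSeries.mul_inv_cancel _ h_ne, one_mul]

theorem regSeries_mem_and_lowRegSeries_mem_and_inv_mem (k j : ℕ) :
    regSeries ℝ j ∈ weightedAlgebra ℝ k 4⁻¹ ∧ lowRegSeries ℝ j ∈ weightedAlgebra ℝ k 4⁻¹ ∧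
      ∀ c : ℝ, -2 < c → c < 2 →
        (lowRegSeries ℝ (j + 1) - C c * regSeries ℝ j)⁻¹ ∈ weightedAlgebra ℝ k 4⁻¹ := by
  induction j with
  | zero =>
    rw [regSeries_zero, lowRegSeries_succ, lowRegSeries_zero, regSeries_zero]
    refine ⟨X_mem_weightedAlgebra, one_mem _, fun c hc hc' => ?_⟩
    have h_norm : ‖2 + c‖ * ((4⁻¹ : ℝ≥0) : ℝ) < 1 := by
      rw [Real.norm_of_nonneg (by linarith)]
      push_cast
      linarith
    convert inv_one_sub_C_mul_X_mem_weightedAlgebra k h_norm using 2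
    rw [map_add, map_ofNat]
    ring
  | succ j ih =>
    obtain ⟨hB, hL, hinv⟩ := ih
    have hL' : lowRegSeries ℝ (j + 1) ∈ weightedAlgebra ℝ k 4⁻¹ := by
      rw [lowRegSeries_succ]
      exact sub_mem hL (mul_mem (ofNat_mem _ 2) hB)
    have hL_inv : (lowRegSeries ℝ (j + 1))⁻¹ ∈ weightedAlgebra ℝ k 4⁻¹ := by
      simpa using hinv 0 (by norm_num) (by norm_num)
    have hL_ne : constantCoeff (lowRegSeries ℝ (j + 1)) ≠ 0 := by
      simp [constantCoeff_lowRegSeries]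
    refine ⟨?_, hL', fun c hc hc' => ?_⟩
    · rw [(PowerSeries.eq_mul_inv_iff_mul_eq hL_ne).2 (regSeries_succ_mul ℝ j)]
      exact mul_mem (pow_mem hB 2) hL_inv
    · have hd : √(2 + c) ^ 2 = 2 + c := Real.sq_sqrt (by linarith)
      have hd0 : 0 ≤ √(2 + c) := Real.sqrt_nonneg _
      have hd2 : √(2 + c) < 2 := by nlinarith
      rw [inv_lowRegSeries_sub hd]
      exact mul_mem hL' (mul_mem (hinv _ (by linarith) (by linarith))
        (hinv _ (by linarith) (by linarith)))

end Regularity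

section SingularExpansion

open PowerSeries
open scoped NNReal

theorem inv_lowRegSeries_mem (k j : ℕ) : (lowRegSeries ℝ j)⁻¹ ∈ weightedAlgebra ℝ k 4⁻¹ := by
  cases j with
  | zero => simp [lowRegSeries_zero, one_mem]
  | succ j =>
    have ⟨_, _, h_inv⟩ := regSeries_mem_and_lowRegSeries_mem_and_inv_mem k j
    simpa using h_inv 0 (by norm_num) (by norm_num)

theorem branchNumerator_mem (k r : ℕ) : branchNumerator ℝ r ∈ weightedAlgebra ℝ k 4⁻¹ :=
  have ⟨h_reg, h_low, _⟩ := regSeries_mem_and_lowRegSeries_mem_and_inv_mem k r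
  mul_mem h_low h_reg

theorem aeval_one_sub_C_mul_X_mem_weightedAlgebra {R : Type*} [NormedCommRing R] (k : ℕ) (ρ : ℝ≥0)
    (a : R) (p : Polynomial R) :
    Polynomial.aeval (1 - C a * X : R⟦X⟧) p ∈ weightedAlgebra R k ρ := by
  have h_mem : 1 - C a * X ∈ weightedAlgebra R k ρ :=
    sub_mem (one_mem _) (mul_mem (algebraMap_mem _ a) X_mem_weightedAlgebra)
  simpa using (Polynomial.aeval (⟨_, h_mem⟩ : weightedAlgebra R k ρ) p).2

/-- The Taylor polynomial at `ε = 0` of `ε / (4 sinh² (2 ^ r artanh √ε))`, for `q = 4 ^ r`. With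
`ε = 1 - 4 X` this function is `branchNumerator r`: the recurrence for `branchNumerator` is the
double-angle formula for `sinh`. -/
noncomputable def singularPoly (q : ℝ) : Polynomial ℝ :=
  .C (1 / (4 * q)) - .C (1 / (6 * q) + 1 / 12) * .X + .C (q / 60 - 1 / (60 * q)) * .X ^ 2 +
    .C (-8 / (945 * q) + q / 90 - q ^ 2 / 378) * .X ^ 3

theorem coeff_singularPoly_zero (q : ℝ) : (singularPoly q).coeff 0 = 1 / (4 * q) := by
  simp [singularPoly]

theorem coeff_singularPoly_one (q : ℝ) :
    (singularPoly q).coeff 1 = -(1 / (6 * q) + 1 / 12) := by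
  simp [singularPoly, Polynomial.coeff_C, Polynomial.coeff_X_pow, -map_add, -map_sub]

theorem coeff_singularPoly_two (q : ℝ) :
    (singularPoly q).coeff 2 = q / 60 - 1 / (60 * q) := by
  simp [singularPoly, -map_sub]

theorem coeff_singularPoly_three (q : ℝ) :
    (singularPoly q).coeff 3 = -8 / (945 * q) + q / 90 - q ^ 2 / 378 := by
  simp [singularPoly, Polynomial.coeff_X_pow, -map_add, -map_sub]

theorem X_pow_four_dvd_singularPoly_recurrence {q : ℝ} (hq : q ≠ 0) :
    .X ^ 4 ∣ singularPoly q ^ 2 - singularPoly (4 * q) * (.X + 4 * singularPoly q) := by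
  refine Polynomial.X_pow_dvd_iff.2 fun d hd => ?_
  simp only [pow_two, Polynomial.coeff_sub, Polynomial.coeff_mul, Polynomial.coeff_add]
  interval_cases d <;>
    simp [Finset.Nat.antidiagonal_succ, Polynomial.coeff_X, coeff_singularPoly_zero,
      coeff_singularPoly_one, coeff_singularPoly_two, coeff_singularPoly_three] <;>
    field_simp <;> ring

theorem branchNumerator_zero_eq_aeval_singularPoly :
    branchNumerator ℝ 0 = Polynomial.aeval (1 - C 4 * X : ℝ⟦X⟧) (singularPoly 1) := by
  have h_quarter : (C (1 / 4) : ℝ⟦X⟧) * C 4 = 1 := by rw [← map_mul]; norm_num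
  have h_poly : singularPoly 1 = .C (1 / 4) - .C (1 / 4) * .X := by norm_num [singularPoly]
  rw [h_poly, branchNumerator_zero]
  simp only [map_sub, map_mul, Polynomial.aeval_X, Polynomial.aeval_C, algebraMap_eq]
  linear_combination (-X) * h_quarter

theorem branchNumerator_succ_sub {K : Type*} [Field K] {r M : ℕ} {p p' g s : K⟦X⟧}
    (h : branchNumerator K r - p = (1 - 4 * X) ^ M * g)
    (hs : p ^ 2 - p' * (1 - 4 * X + 4 * p) = (1 - 4 * X) ^ M * s) :
    branchNumerator K (r + 1) - p' = (1 - 4 * X) ^ M *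
      ((lowRegSeries K r)⁻¹ ^ 2 * (s + g * (branchNumerator K r + p) - 4 * p' * g)) := by
  have h_inv : lowRegSeries K r * (lowRegSeries K r)⁻¹ = 1 :=
    PowerSeries.mul_inv_cancel _ (by simp [constantCoeff_lowRegSeries])
  have h_mul : lowRegSeries K r ^ 2 * (branchNumerator K (r + 1) - p') =
      (1 - 4 * X) ^ M * (s + g * (branchNumerator K r + p) - 4 * p' * g) := by
    linear_combination branchNumerator_succ_mul K r - p' * lowRegSeries_sq K r + hs +
      (branchNumerator K r + p - 4 * p') * h
  linear_combination (lowRegSeries K r)⁻¹ ^ 2 * h_mul - (branchNumerator K (r + 1) - p') *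
    (lowRegSeries K r * (lowRegSeries K r)⁻¹ + 1) * h_inv

theorem exists_branchNumerator_sub_singularPoly (k r : ℕ) :
    ∃ g ∈ weightedAlgebra ℝ k 4⁻¹,
      branchNumerator ℝ r - Polynomial.aeval (1 - C 4 * X : ℝ⟦X⟧) (singularPoly (4 ^ r)) =
        (1 - C 4 * X) ^ 4 * g := by
  induction r with
  | zero =>
    refine ⟨0, zero_mem _, ?_⟩
    rw [pow_zero, branchNumerator_zero_eq_aeval_singularPoly, sub_self, mul_zero]
  | succ r ih =>
    obtain ⟨g, hg, h_eq⟩ := ih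
    obtain ⟨s, hs⟩ := X_pow_four_dvd_singularPoly_recurrence (q := 4 ^ r) (by positivity)
    replace hs := congrArg (Polynomial.aeval (1 - C 4 * X : ℝ⟦X⟧)) hs
    have h_aeval := aeval_one_sub_C_mul_X_mem_weightedAlgebra k 4⁻¹ (4 : ℝ)
    simp only [map_sub, map_mul, map_add, map_pow, Polynomial.aeval_X, map_ofNat]
      at h_eq hs h_aeval ⊢
    rw [pow_succ']
    refine ⟨_, ?_, branchNumerator_succ_sub h_eq hs⟩
    exact mul_mem (pow_mem (inv_lowRegSeries_mem k r) 2) (sub_mem (add_mem (h_aeval s)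
      (mul_mem hg (add_mem (branchNumerator_mem k r) (h_aeval _))))
      (mul_mem (mul_mem (ofNat_mem _ 4) (h_aeval _)) hg))

end SingularExpansion

section OneSubPow

open PowerSeries Filter Topology Asymptotics

variable {K : Type*} [Field K] [CharZero K]

/-- The binomial series of `(1 - a X) ^ α`. -/
noncomputable def oneSubPow (a α : K) : K⟦X⟧ := rescale (-a) (binomialSeries K α)

theorem coeff_oneSubPow (a α : K) (n : ℕ) :
    coeff n (oneSubPow a α) = a ^ n * ((-1) ^ n * Ring.choose α n) := by
  rw [oneSubPow, coeff_rescale, binomialSeries_coeff, smul_eq_mul, mul_one, neg_pow]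
  ring

theorem constantCoeff_oneSubPow (a α : K) : constantCoeff (oneSubPow a α) = 1 := by
  rw [← coeff_zero_eq_constantCoeff_apply, coeff_oneSubPow, Ring.choose_zero_right]
  simp

theorem oneSubPow_add (a α β : K) : oneSubPow a (α + β) = oneSubPow a α * oneSubPow a β := by
  rw [oneSubPow, binomialSeries_add, map_mul, oneSubPow, oneSubPow]

theorem oneSubPow_natCast (a : K) (m : ℕ) : oneSubPow a (m : K) = (1 - C a * X) ^ m := by
  rw [oneSubPow, binomialSeries_nat, map_pow, map_add, map_one, rescale_X, map_neg, neg_mul,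
    sub_eq_add_neg]

theorem oneSubPow_neg_mul (a α : K) : oneSubPow a (-α) * oneSubPow a α = 1 := by
  rw [← oneSubPow_add, neg_add_cancel, ← Nat.cast_zero, oneSubPow_natCast, pow_zero]

theorem add_one_mul_choose_succ (α : K) (n : ℕ) :
    ((n : K) + 1) * Ring.choose α (n + 1) = (α - n) * Ring.choose α n := by
  have h := Ring.choose_smul_choose α n.le_succ
  rw [Nat.choose_succ_self_right, Nat.succ_sub le_rfl, Nat.sub_self, Ring.choose_one_right,
    nsmul_eq_mul] at h
  push_cast at h
  rw [h, mul_comm]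

theorem add_one_sub_mul_coeff_oneSubPow (a α : K) (n : ℕ) :
    (α + 1 - n) * coeff n (oneSubPow a (α + 1)) = (α + 1) * coeff n (oneSubPow a α) := by
  have h := Ring.choose_smul_choose (α + 1) (Nat.le_add_left 1 n)
  rw [Nat.choose_one_right, Nat.add_sub_cancel, Ring.choose_one_right, nsmul_eq_mul, Nat.cast_one,
    add_sub_cancel_right] at h
  push_cast at h
  rw [coeff_oneSubPow, coeff_oneSubPow]
  linear_combination (a ^ n * (-1) ^ n) * (h - add_one_mul_choose_succ (α + 1) n)

theorem neg_one_pow_mul_choose (α : K) (n : ℕ) :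
    (-1) ^ n * Ring.choose α n = (∏ j ∈ Finset.range n, (-α + j)) / n.factorial := by
  induction n with
  | zero => simp
  | succ n ih =>
    have hn : (n : K) + 1 ≠ 0 := n.cast_add_one_ne_zero
    rw [Finset.prod_range_succ, Nat.factorial_succ, Nat.cast_mul, Nat.cast_add_one,
      mul_comm ((n : K) + 1), mul_div_mul_comm, ← ih, mul_div_assoc', eq_div_iff hn]
    linear_combination (-1) ^ (n + 1) * add_one_mul_choose_succ α n

theorem coeff_oneSubPow_ne_zero {a α : K} (ha : a ≠ 0) (hα : ∀ m : ℕ, α ≠ m) (n : ℕ) :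
    coeff n (oneSubPow a α) ≠ 0 := by
  rw [coeff_oneSubPow, neg_one_pow_mul_choose]
  refine mul_ne_zero (pow_ne_zero n ha) (div_ne_zero (Finset.prod_ne_zero_iff.2 fun j _ h => ?_)
    (Nat.cast_ne_zero.2 n.factorial_ne_zero))
  exact hα j (neg_add_eq_zero.1 h)

theorem tendsto_neg_one_pow_mul_choose_mul_rpow {α : ℝ} (hα : ∀ m : ℕ, α ≠ m) :
    Tendsto (fun n : ℕ => (-1) ^ n * Ring.choose α n * (n : ℝ) ^ (α + 1)) atTop
      (𝓝 (Real.Gamma (-α))⁻¹) := by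
  have h_ratio : Tendsto (fun n : ℕ => (n : ℝ) / (n + -α)) atTop (𝓝 1) :=
    tendsto_natCast_div_add_atTop (-α)
  have h_gamma := (Real.GammaSeq_tendsto_Gamma (-α)).inv₀
    (Real.Gamma_ne_zero fun m h => hα m (by linarith))
  refine ((h_ratio.mul h_gamma).congr' ?_).trans_eq (by rw [one_mul])
  filter_upwards [eventually_gt_atTop 0] with n hn
  have hn' : (0 : ℝ) < n := by exact_mod_cast hn
  have h_ne : (n : ℝ) + -α ≠ 0 := fun h => hα n (by linarith)
  rw [neg_one_pow_mul_choose, Real.GammaSeq, Finset.prod_range_succ, Real.rpow_neg hn'.le,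
    Real.rpow_add_one hn'.ne']
  field_simp
  ring

theorem isTheta_coeff_oneSubPow (a : ℝ) {α : ℝ} (hα : ∀ m : ℕ, α ≠ m) :
    (fun n : ℕ => coeff n (oneSubPow a α)) =Θ[atTop] fun n : ℕ => a ^ n * (n : ℝ) ^ (-(α + 1)) := by
  simp only [coeff_oneSubPow]
  refine (isTheta_refl _ _).mul (IsTheta.symm ?_)
  have h_lim : (Real.Gamma (-α))⁻¹ ≠ 0 :=
    inv_ne_zero (Real.Gamma_ne_zero fun m h => hα m (by linarith))
  refine isTheta_of_div_tendsto_nhds_ne_zero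
    ((tendsto_neg_one_pow_mul_choose_mul_rpow hα).congr fun n => ?_) h_lim
  rw [Real.rpow_neg n.cast_nonneg, div_inv_eq_mul]

end OneSubPow

section Transfer

open PowerSeries Finset Filter Asymptotics
open scoped NNReal

theorem rpow_neg_le_mul_rpow_neg_add {β : ℝ} {k : ℕ} (hβ : 0 ≤ β) (hk : β ≤ k) (i j : ℕ) :
    ((i : ℝ) + 1) ^ (-β) ≤ ((i + j : ℕ) + 1 : ℝ) ^ (-β) * ((j : ℝ) + 1) ^ k := by
  have hi : (0 : ℝ) < i + 1 := by positivity
  have hij : (0 : ℝ) < (i + j : ℕ) + 1 := by positivity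
  rw [Real.rpow_neg hi.le, Real.rpow_neg hij.le, inv_mul_eq_div, le_div_iff₀ (by positivity),
    inv_mul_le_iff₀ (by positivity)]
  have h_le : ((i + j : ℕ) + 1 : ℝ) ≤ (i + 1) * (j + 1) := by
    push_cast
    nlinarith [mul_nonneg (Nat.cast_nonneg (α := ℝ) i) (Nat.cast_nonneg (α := ℝ) j)]
  grw [h_le, Real.mul_rpow hi.le (by positivity), ← Real.rpow_natCast]
  gcongr
  simp

theorem isTheta_rpow_add_one (β : ℝ) :
    (fun n : ℕ => (n : ℝ) ^ β) =Θ[atTop] fun n : ℕ => ((n : ℝ) + 1) ^ β := by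
  refine IsTheta.rpow (Eventually.of_forall fun n => by positivity)
    (Eventually.of_forall fun n => by positivity) ?_
  have h_one : (fun _ : ℕ => (1 : ℝ)) =o[atTop] fun n : ℕ => (n : ℝ) :=
    (isLittleO_const_id_atTop 1).comp_tendsto tendsto_natCast_atTop_atTop
  exact (IsEquivalent.refl.add_isLittleO h_one).isTheta.symm

/-- A series with summable coefficients only redistributes those of `f`, and the polynomial weight
absorbs the loss from shifting the index. -/
theorem isBigO_coeff_mul {R : Type*} [NormedCommRing R] {f g : R⟦X⟧} {k : ℕ} {ρ : ℝ≥0} {β : ℝ}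
    (hρ : 0 < ρ) (hβ : 0 ≤ β) (hk : β ≤ k) (hg : g ∈ weightedAlgebra R k ρ)
    (hf : (fun n => coeff n f) =O[atTop] fun n : ℕ => ((ρ : ℝ) ^ n)⁻¹ * (n : ℝ) ^ (-β)) :
    (fun n => coeff n (f * g)) =O[atTop] fun n : ℕ => ((ρ : ℝ) ^ n)⁻¹ * (n : ℝ) ^ (-β) := by
  have h_shift : (fun n : ℕ => ((ρ : ℝ) ^ n)⁻¹ * (n : ℝ) ^ (-β)) =Θ[atTop]
      fun n : ℕ => ((ρ : ℝ) ^ n)⁻¹ * ((n : ℝ) + 1) ^ (-β) :=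
    (isTheta_refl _ _).mul (isTheta_rpow_add_one _)
  rw [h_shift.isBigO_congr_right] at hf ⊢
  obtain ⟨M, hM, h_bound⟩ := bound_of_isBigO_nat_atTop hf
  rw [mem_weightedAlgebra] at hg
  refine IsBigO.of_bound (M * ∑' n, ‖coeff n g‖ * (((n : ℝ) + 1) ^ k * ρ ^ n))
    (Eventually.of_forall fun n => ?_)
  have h_term {ij : ℕ × ℕ} (hij : ij ∈ antidiagonal n) :
      ‖coeff ij.1 g * coeff ij.2 f‖ ≤ M * (((ρ : ℝ) ^ n)⁻¹ * ((n : ℝ) + 1) ^ (-β)) *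
        (‖coeff ij.1 g‖ * (((ij.1 : ℝ) + 1) ^ k * ρ ^ ij.1)) := by
    obtain ⟨i, j⟩ := ij
    obtain rfl := mem_antidiagonal.1 hij
    have h_f := h_bound (x := j) (by positivity)
    rw [Real.norm_of_nonneg (by positivity)] at h_f
    grw [norm_mul_le, h_f, rpow_neg_le_mul_rpow_neg_add hβ hk j i]
    rw [pow_add, add_comm j i]
    field_simp
    rfl
  have h_sum : ∑ ij ∈ antidiagonal n, ‖coeff ij.1 g‖ * (((ij.1 : ℝ) + 1) ^ k * ρ ^ ij.1) ≤
      ∑' n, ‖coeff n g‖ * (((n : ℝ) + 1) ^ k * ρ ^ n) := by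
    rw [Nat.sum_antidiagonal_eq_sum_range_succ_mk]
    exact hg.sum_le_tsum _ fun n _ => by positivity
  rw [mul_comm f, coeff_mul, Real.norm_of_nonneg (by positivity)]
  grw [norm_sum_le, sum_le_sum fun ij hij => h_term hij]
  rw [← mul_sum]
  grw [h_sum]
  exact (mul_right_comm _ _ _).le

theorem exists_polynomial_eq_sum_add {R : Type*} [CommRing R] (p : Polynomial R) (M : ℕ) :
    ∃ s, p = ∑ i ∈ range M, .C (p.coeff i) * .X ^ i + .X ^ M * s := by
  have h_dvd : .X ^ M ∣ p - ∑ i ∈ range M, .C (p.coeff i) * .X ^ i := by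
    refine Polynomial.X_pow_dvd_iff.2 fun d hd => ?_
    simp [Polynomial.coeff_X_pow, hd]
  obtain ⟨s, hs⟩ := h_dvd
  exact ⟨s, by rw [← hs, add_sub_cancel]⟩

theorem isBigO_coeff_oneSubPow_mul {a : ℝ≥0} {k M : ℕ} {α : ℝ} (ha : 0 < a)
    (hα : ∀ m : ℕ, α + M ≠ m) (hα0 : 0 ≤ α + M + 1) (hk : α + M + 1 ≤ k) {f g : ℝ⟦X⟧}
    {p : Polynomial ℝ} (hg : g ∈ weightedAlgebra ℝ k a⁻¹)
    (hf : f - Polynomial.aeval (1 - C (a : ℝ) * X) p = (1 - C (a : ℝ) * X) ^ M * g) :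
    (fun n => coeff n (oneSubPow (a : ℝ) α * f) -
        ∑ i ∈ range M, p.coeff i * coeff n (oneSubPow (a : ℝ) (α + i))) =O[atTop]
      fun n : ℕ => (a : ℝ) ^ n * (n : ℝ) ^ (-(α + M + 1)) := by
  obtain ⟨s, hs⟩ := exists_polynomial_eq_sum_add p M
  have h_aeval := congrArg (Polynomial.aeval (1 - C (a : ℝ) * X)) hs
  simp only [map_add, map_sum, map_mul, map_pow, Polynomial.aeval_C, Polynomial.aeval_X,
    algebraMap_eq] at h_aeval
  have h_expand : oneSubPow (a : ℝ) α * f =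
      ∑ i ∈ range M, C (p.coeff i) * oneSubPow (a : ℝ) (α + i) +
        oneSubPow (a : ℝ) (α + M) * (Polynomial.aeval (1 - C (a : ℝ) * X) s + g) := by
    simp only [oneSubPow_add, oneSubPow_natCast, mul_left_comm (C _) (oneSubPow _ _), ← mul_sum]
    linear_combination oneSubPow (a : ℝ) α * (hf + h_aeval)
  have h_remainder := isBigO_coeff_mul (inv_pos.2 ha) hα0 hk
    (add_mem (aeval_one_sub_C_mul_X_mem_weightedAlgebra k a⁻¹ (a : ℝ) s) hg)
    ((isTheta_coeff_oneSubPow (a : ℝ) hα).isBigO.congr_right fun n => by simp)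
  refine h_remainder.congr (fun n => ?_) (fun n => by simp)
  simp [h_expand]

theorem isBigO_coeff_oneSubPow_mul_div {a : ℝ≥0} {k M : ℕ} {α β : ℝ} (ha : 0 < a)
    (hα : ∀ m : ℕ, α + M ≠ m) (hβ : ∀ m : ℕ, β ≠ m) (hα0 : 0 ≤ α + M + 1) (hk : α + M + 1 ≤ k)
    {f g : ℝ⟦X⟧} {p : Polynomial ℝ} (hg : g ∈ weightedAlgebra ℝ k a⁻¹)
    (hf : f - Polynomial.aeval (1 - C (a : ℝ) * X) p = (1 - C (a : ℝ) * X) ^ M * g) :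
    (fun n => coeff n (oneSubPow (a : ℝ) α * f) / coeff n (oneSubPow (a : ℝ) β) -
        ∑ i ∈ range M, p.coeff i *
          (coeff n (oneSubPow (a : ℝ) (α + i)) / coeff n (oneSubPow (a : ℝ) β))) =O[atTop]
      fun n : ℕ => (n : ℝ) ^ (β - α - M) := by
  have h_div := (isBigO_coeff_oneSubPow_mul ha hα hα0 hk hg hf).mul
    (isTheta_coeff_oneSubPow (a : ℝ) hβ).inv.isBigO
  refine h_div.congr' (Eventually.of_forall fun n => ?_) ?_
  · simp only [← div_eq_mul_inv, sub_div, sum_div, mul_div_assoc]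
  · filter_upwards [eventually_gt_atTop 0] with n hn
    have hn' : (0 : ℝ) < n := by exact_mod_cast hn
    have ha' : (a : ℝ) ^ n ≠ 0 := by positivity
    rw [mul_inv, ← Real.rpow_neg hn'.le, mul_mul_mul_comm, mul_inv_cancel₀ ha', one_mul,
      ← Real.rpow_add hn']
    ring_nf

end Transfer

section HalfIntegerExponents

open PowerSeries

theorem intCast_add_half_ne_natCast (z : ℤ) (m : ℕ) : (z : ℝ) + 1 / 2 ≠ m := by
  intro h
  have h_int : 2 * z + 1 = 2 * m := by
    have : 2 * (z : ℝ) + 1 = 2 * m := by linarith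
    exact_mod_cast this
  omega

theorem half_ne_natCast (m : ℕ) : (1 / 2 : ℝ) ≠ m := by
  simpa using intCast_add_half_ne_natCast 0 m

theorem two_mul_natCast_sub_one_ne_zero (n : ℕ) : 2 * (n : ℝ) - 1 ≠ 0 := fun h =>
  half_ne_natCast n (by linarith)

theorem two_mul_natCast_sub_three_ne_zero (n : ℕ) : 2 * (n : ℝ) - 3 ≠ 0 := fun h =>
  intCast_add_half_ne_natCast 1 n (by push_cast; linarith)

variable {a : ℝ} (ha : a ≠ 0) (n : ℕ)
include ha

theorem coeff_oneSubPow_half_ne_zero : coeff n (oneSubPow a (1 / 2)) ≠ 0 :=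
  coeff_oneSubPow_ne_zero ha half_ne_natCast n

theorem coeff_oneSubPow_neg_half_div :
    coeff (n + 1) (oneSubPow a (-1 / 2)) / coeff (n + 1) (oneSubPow a (1 / 2)) = -(2 * n + 1) := by
  have h := add_one_sub_mul_coeff_oneSubPow a (-1 / 2) (n + 1)
  rw [div_eq_iff (coeff_oneSubPow_half_ne_zero ha _)]
  norm_num at h ⊢
  linarith

theorem coeff_oneSubPow_neg_three_halves_div :
    coeff (n + 1) (oneSubPow a (-3 / 2)) / coeff (n + 1) (oneSubPow a (1 / 2)) =
      -((2 * n + 1) * (2 * n + 3)) := by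
  have h := add_one_sub_mul_coeff_oneSubPow a (-3 / 2) (n + 1)
  have h' := coeff_oneSubPow_neg_half_div ha n
  rw [div_eq_iff (coeff_oneSubPow_half_ne_zero ha _)] at h' ⊢
  norm_num at h h' ⊢
  linear_combination 2 * h + (2 * n + 3) * h'

theorem coeff_oneSubPow_three_halves_div :
    coeff (n + 1) (oneSubPow a (3 / 2)) / coeff (n + 1) (oneSubPow a (1 / 2)) =
      -(3 / (2 * n - 1)) := by
  have h := add_one_sub_mul_coeff_oneSubPow a (1 / 2) (n + 1)
  have h_ne := two_mul_natCast_sub_one_ne_zero n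
  rw [div_eq_iff (coeff_oneSubPow_half_ne_zero ha _), ← neg_div, div_mul_eq_mul_div,
    eq_div_iff h_ne]
  norm_num at h ⊢
  linear_combination -2 * h

theorem coeff_oneSubPow_five_halves_div :
    coeff (n + 1) (oneSubPow a (5 / 2)) / coeff (n + 1) (oneSubPow a (1 / 2)) =
      15 / ((2 * n - 1) * (2 * n - 3)) := by
  have h := add_one_sub_mul_coeff_oneSubPow a (3 / 2) (n + 1)
  have h' := coeff_oneSubPow_three_halves_div ha n
  have h_ne := two_mul_natCast_sub_one_ne_zero n
  have h_ne' := two_mul_natCast_sub_three_ne_zero n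
  rw [div_eq_iff (coeff_oneSubPow_half_ne_zero ha _)] at h' ⊢
  norm_num at h h' ⊢
  rw [h'] at h
  field_simp at h ⊢
  linear_combination -h

end HalfIntegerExponents

section Moments

open PowerSeries Finset Filter Asymptotics
open scoped NNReal

theorem one_sub_treeSeries_one_eq_oneSubPow :
    1 - 2 * X * treeSeries (1 : BinaryTree Unit → ℝ) = oneSubPow 4 (1 / 2) := by
  have h_sq : oneSubPow (4 : ℝ) (1 / 2) ^ 2 = 1 - 4 * X := by
    rw [sq, ← oneSubPow_add, add_halves, ← Nat.cast_one, oneSubPow_natCast, pow_one, map_ofNat]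
  refine (sq_eq_sq_iff_eq_or_eq_neg.1
    ((one_sub_treeSeries_one_sq ℝ).trans h_sq.symm)).resolve_right fun h => ?_
  have h_const := congrArg constantCoeff h
  norm_num [constantCoeff_oneSubPow] at h_const

theorem X_mul_treeSeries_numBranches (r : ℕ) :
    X * treeSeries (fun t => (numBranches r t : ℝ)) =
      oneSubPow 4 (-1 / 2) * branchNumerator ℝ r := by
  have h_inv := oneSubPow_neg_mul (4 : ℝ) (1 / 2)
  rw [← neg_div] at h_inv
  rw [← treeSeries_numBranches_mul, one_sub_treeSeries_one_eq_oneSubPow]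
  linear_combination -(X * treeSeries fun t => (numBranches r t : ℝ)) * h_inv

theorem X_mul_treeSeries_numBranches_mul_sub_one (r : ℕ) :
    X * treeSeries (fun t => (numBranches r t * (numBranches r t - 1) : ℝ)) =
      2 * (oneSubPow 4 (-3 / 2) * branchNumerator ℝ r ^ 2) := by
  have h_inv := oneSubPow_neg_mul (4 : ℝ) (1 / 2)
  have h_pow : oneSubPow (4 : ℝ) (-3 / 2) = oneSubPow 4 (-1 / 2) ^ 3 := by
    rw [pow_succ, sq, ← oneSubPow_add, ← oneSubPow_add]
    norm_num
  have h_mul := treeSeries_numBranches_mul_sub_one_mul ℝ r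
  have h_first := X_mul_treeSeries_numBranches r
  rw [← neg_div] at h_inv
  rw [one_sub_treeSeries_one_eq_oneSubPow] at h_mul
  rw [h_pow]
  linear_combination
    (-X * treeSeries fun t => (numBranches r t * (numBranches r t - 1) : ℝ)) * h_inv +
      X * oneSubPow 4 (-1 / 2) * h_mul +
      2 * oneSubPow 4 (-1 / 2) * (X * treeSeries (fun t => (numBranches r t : ℝ)) +
        oneSubPow 4 (-1 / 2) * branchNumerator ℝ r) * h_first

theorem coeff_succ_oneSubPow_four_half (n : ℕ) :
    coeff (n + 1) (oneSubPow (4 : ℝ) (1 / 2)) = -2 * (treesOfNumNodesEq n).card := by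
  rw [← one_sub_treeSeries_one_eq_oneSubPow, mul_assoc, map_sub, coeff_one, if_neg n.succ_ne_zero,
    ← map_ofNat C 2, coeff_C_mul, coeff_succ_X_mul, coeff_treeSeries]
  simp

theorem expectation_eq_coeff_div (n : ℕ) (f : BinaryTree Unit → ℝ) :
    expectation n f =
      -2 * (coeff (n + 1) (X * treeSeries f) / coeff (n + 1) (oneSubPow 4 (1 / 2))) := by
  rw [expectation, coeff_succ_oneSubPow_four_half, coeff_succ_X_mul,
    coeff_treeSeries, div_mul_eq_div_div_swap]
  ring

theorem isBigO_comp_succ_of_rpow {f : ℕ → ℝ} {d : ℕ}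
    (hf : f =O[atTop] fun n : ℕ => (n : ℝ) ^ (-(d : ℝ))) :
    (fun n => f (n + 1)) =O[atTop] fun n : ℕ => 1 / (n : ℝ) ^ d := by
  have h_shift := (isTheta_rpow_add_one (-(d : ℝ))).symm.isBigO
  refine ((hf.comp_tendsto (tendsto_add_atTop_nat 1)).congr_right fun n => ?_).trans
    (h_shift.congr_right fun n => ?_)
  · simp
  · rw [Real.rpow_neg n.cast_nonneg, Real.rpow_natCast, one_div]

theorem isBigO_expectation_numBranches (r : ℕ) :
    (fun n : ℕ => expectation n (fun t => (numBranches r t : ℝ)) -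
        2 * ((singularPoly (4 ^ r)).coeff 0 * (2 * n + 1) - (singularPoly (4 ^ r)).coeff 1 +
          (singularPoly (4 ^ r)).coeff 2 * (3 / (2 * n - 1)) -
          (singularPoly (4 ^ r)).coeff 3 * (15 / ((2 * n - 1) * (2 * n - 3)))))
      =O[atTop] fun n : ℕ => 1 / (n : ℝ) ^ 3 := by
  obtain ⟨g, hg, h_eq⟩ := exists_branchNumerator_sub_singularPoly 5 r
  have h_coeff := isBigO_comp_succ_of_rpow (d := 3)
    ((isBigO_coeff_oneSubPow_mul_div (a := 4) (α := -1 / 2) (β := 1 / 2) (M := 4) (by norm_num)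
      (fun m h => intCast_add_half_ne_natCast 3 m (by norm_num at h ⊢; linarith)) half_ne_natCast
      (by norm_num) (by norm_num) hg (by simpa using h_eq)).congr_right fun n => by norm_num)
  refine (h_coeff.const_mul_left (-2)).congr_left fun n => ?_
  rw [expectation_eq_coeff_div, X_mul_treeSeries_numBranches]
  simp only [sum_range_succ, sum_range_zero, NNReal.coe_ofNat]
  rw [show (-1 / 2 : ℝ) + (0 : ℕ) = -1 / 2 by norm_num,
    show (-1 / 2 : ℝ) + (1 : ℕ) = 1 / 2 by norm_num,
    show (-1 / 2 : ℝ) + (2 : ℕ) = 3 / 2 by norm_num,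
    show (-1 / 2 : ℝ) + (3 : ℕ) = 5 / 2 by norm_num,
    coeff_oneSubPow_neg_half_div four_ne_zero,
    div_self (coeff_oneSubPow_half_ne_zero four_ne_zero _),
    coeff_oneSubPow_three_halves_div four_ne_zero, coeff_oneSubPow_five_halves_div four_ne_zero]
  ring

theorem isBigO_expectation_numBranches_mul_sub_one (r : ℕ) :
    (fun n : ℕ => expectation n (fun t => (numBranches r t * (numBranches r t - 1) : ℝ)) -
        4 * ((singularPoly (4 ^ r) ^ 2).coeff 0 * ((2 * n + 1) * (2 * n + 3)) +
          (singularPoly (4 ^ r) ^ 2).coeff 1 * (2 * n + 1) - (singularPoly (4 ^ r) ^ 2).coeff 2 +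
          (singularPoly (4 ^ r) ^ 2).coeff 3 * (3 / (2 * n - 1))))
      =O[atTop] fun n : ℕ => 1 / (n : ℝ) ^ 2 := by
  obtain ⟨g, hg, h_eq⟩ := exists_branchNumerator_sub_singularPoly 5 r
  set u := Polynomial.aeval (1 - C 4 * X : ℝ⟦X⟧) (singularPoly (4 ^ r)) with hu
  have h_sq : branchNumerator ℝ r ^ 2 - u ^ 2 =
      (1 - C 4 * X) ^ 4 * (g * (branchNumerator ℝ r + u)) := by
    linear_combination (branchNumerator ℝ r + u) * h_eq
  have h_mem : g * (branchNumerator ℝ r + u) ∈ weightedAlgebra ℝ 5 4⁻¹ :=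
    mul_mem hg (add_mem (branchNumerator_mem 5 r)
      (aeval_one_sub_C_mul_X_mem_weightedAlgebra 5 4⁻¹ 4 _))
  rw [hu, ← map_pow] at h_sq
  have h_coeff := isBigO_comp_succ_of_rpow (d := 2)
    ((isBigO_coeff_oneSubPow_mul_div (a := 4) (α := -3 / 2) (β := 1 / 2) (M := 4) (by norm_num)
      (fun m h => intCast_add_half_ne_natCast 2 m (by norm_num at h ⊢; linarith)) half_ne_natCast
      (by norm_num) (by norm_num) h_mem
      (by simpa only [NNReal.coe_ofNat] using h_sq)).congr_right fun n => by norm_num)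
  refine (h_coeff.const_mul_left (-4)).congr_left fun n => ?_
  rw [expectation_eq_coeff_div, X_mul_treeSeries_numBranches_mul_sub_one, ← map_ofNat C 2,
    coeff_C_mul]
  simp only [sum_range_succ, sum_range_zero, NNReal.coe_ofNat]
  rw [show (-3 / 2 : ℝ) + (0 : ℕ) = -3 / 2 by norm_num,
    show (-3 / 2 : ℝ) + (1 : ℕ) = -1 / 2 by norm_num,
    show (-3 / 2 : ℝ) + (2 : ℕ) = 1 / 2 by norm_num,
    show (-3 / 2 : ℝ) + (3 : ℕ) = 3 / 2 by norm_num,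
    coeff_oneSubPow_neg_three_halves_div four_ne_zero, coeff_oneSubPow_neg_half_div four_ne_zero,
    div_self (coeff_oneSubPow_half_ne_zero four_ne_zero _),
    coeff_oneSubPow_three_halves_div four_ne_zero]
  ring

end Moments

section AsymptoticExpansions

open Finset Filter Asymptotics

theorem isBigO_one_div_natCast_pow {i j : ℕ} (h : i ≤ j) :
    (fun n : ℕ => 1 / (n : ℝ) ^ j) =O[atTop] fun n : ℕ => 1 / (n : ℝ) ^ i := by
  refine IsBigO.of_bound 1 ?_
  filter_upwards [eventually_ge_atTop 1] with n hn
  have hn' : (1 : ℝ) ≤ n := by exact_mod_cast hn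
  rw [Real.norm_of_nonneg (by positivity), Real.norm_of_nonneg (by positivity), one_mul]
  gcongr

theorem one_div_sub_eq_sum_add {x b : ℝ} (hx : x ≠ 0) (h_sub : x - b ≠ 0) (M : ℕ) :
    1 / (x - b) =
      ∑ i ∈ range M, b ^ i * (1 / x ^ (i + 1)) + b ^ M * (1 / x ^ M) * (1 / (x - b)) := by
  induction M with
  | zero => simp
  | succ M ih =>
    have h_step : 1 / (x - b) = 1 / x + b * (1 / x) * (1 / (x - b)) := by
      field_simp
      ring
    rw [sum_range_succ]
    linear_combination ih + b ^ M * (1 / x ^ M) * h_step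

theorem isBigO_one_div_sub_sum (b : ℝ) (M : ℕ) :
    (fun n : ℕ => 1 / ((n : ℝ) - b) - ∑ i ∈ range M, b ^ i * (1 / (n : ℝ) ^ (i + 1)))
      =O[atTop] fun n : ℕ => 1 / (n : ℝ) ^ (M + 1) := by
  have h_shift : (fun n : ℕ => (n : ℝ) - b) ~[atTop] fun n : ℕ => (n : ℝ) :=
    IsEquivalent.refl.sub_isLittleO
      ((isLittleO_const_id_atTop b).comp_tendsto tendsto_natCast_atTop_atTop)
  have h_tail : (fun n : ℕ => b ^ M * (1 / (n : ℝ) ^ M) * ((n : ℝ) - b)⁻¹)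
      =O[atTop] fun n : ℕ => 1 / (n : ℝ) ^ M * (n : ℝ)⁻¹ :=
    ((isBigO_refl _ _).const_mul_left _).mul h_shift.inv.isBigO
  refine h_tail.congr' ?_ (Eventually.of_forall fun n => by simp only [one_div, pow_succ, mul_inv])
  filter_upwards [eventually_gt_atTop 0, tendsto_natCast_atTop_atTop.eventually_gt_atTop b]
    with n hn hnb
  rw [one_div_sub_eq_sum_add (Nat.cast_ne_zero.2 hn.ne') (sub_pos.2 hnb).ne' M,
    add_sub_cancel_left, one_div ((n : ℝ) - b)]

theorem isBigO_sq_sub {m : ℕ → ℝ} {a b c d : ℝ}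
    (h : (fun n : ℕ => m n - (a * n + b + c * (1 / n) + d * (1 / (n : ℝ) ^ 2)))
      =O[atTop] fun n : ℕ => 1 / (n : ℝ) ^ 3) :
    (fun n : ℕ => m n ^ 2 - (a ^ 2 * (n : ℝ) ^ 2 + 2 * a * b * n + (b ^ 2 + 2 * a * c) +
      (2 * a * d + 2 * b * c) * (1 / n))) =O[atTop] fun n : ℕ => 1 / (n : ℝ) ^ 2 := by
  set u : ℕ → ℝ := fun n => a * n + b + c * (1 / n) + d * (1 / (n : ℝ) ^ 2) with hu
  have h_inv (j : ℕ) : (fun n : ℕ => 1 / (n : ℝ) ^ j) =O[atTop] fun n : ℕ => (n : ℝ) := by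
    refine (isBigO_one_div_natCast_pow j.zero_le).trans ?_
    simpa only [pow_zero, div_one] using! ((isLittleO_const_id_atTop (1 : ℝ)).comp_tendsto
      tendsto_natCast_atTop_atTop).isBigO
  have h_lin : u =O[atTop] fun n : ℕ => (n : ℝ) := by
    have h_terms := ((((isBigO_refl _ _).const_mul_left a).add ((h_inv 0).const_mul_left b)).add
      ((h_inv 1).const_mul_left c)).add ((h_inv 2).const_mul_left d)
    simpa [hu] using h_terms
  have h_cross : (fun n => (m n - u n) * (m n - u n + 2 * u n))
      =O[atTop] fun n : ℕ => 1 / (n : ℝ) ^ 2 := by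
    refine (h.mul ((h.trans (h_inv 3)).add (h_lin.const_mul_left 2))).congr' (by rfl) ?_
    filter_upwards [eventually_gt_atTop 0] with n hn
    have hn' : (n : ℝ) ≠ 0 := by exact_mod_cast hn.ne'
    field_simp
  have h_tail := (((isBigO_one_div_natCast_pow (le_refl 2)).const_mul_left (c ^ 2 + 2 * b * d)).add
    ((isBigO_one_div_natCast_pow (show 2 ≤ 3 by norm_num)).const_mul_left (2 * c * d))).add
    ((isBigO_one_div_natCast_pow (show 2 ≤ 4 by norm_num)).const_mul_left (d ^ 2))
  refine (h_cross.add h_tail).congr' ?_ (by rfl)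
  filter_upwards [eventually_gt_atTop 0] with n hn
  have hn' : (n : ℝ) ≠ 0 := by exact_mod_cast hn.ne'
  simp only [hu]
  field_simp
  ring

theorem variance_eq (n : ℕ) (f : BinaryTree Unit → ℝ) :
    variance n f = expectation n (fun t => f t * (f t - 1)) + expectation n f -
      expectation n f ^ 2 := by
  have h_card : ((treesOfNumNodesEq n).card : ℝ) ≠ 0 := by
    have h_coeff := coeff_oneSubPow_half_ne_zero (four_ne_zero : (4 : ℝ) ≠ 0) (n + 1)
    rw [coeff_succ_oneSubPow_four_half] at h_coeff
    exact right_ne_zero_of_mul h_coeff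
  rw [variance]
  set m := expectation n f with hm
  have h_sum : ∑ t ∈ treesOfNumNodesEq n, f t = m * (treesOfNumNodesEq n).card := by
    rw [hm, expectation, div_mul_cancel₀ _ h_card]
  have h_sq (t : BinaryTree Unit) :
      (f t - m) ^ 2 = f t * (f t - 1) + (1 - 2 * m) * f t + m ^ 2 := by
    ring
  simp only [expectation, h_sq, sum_add_distrib, ← mul_sum, h_sum, sum_const, nsmul_eq_mul]
  field_simp
  ring

theorem expectation_numBranches_expansion (r : ℕ) :
    (fun n : ℕ => expectation n (fun t => (numBranches r t : ℝ)) -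
        (1 / 4 ^ r * n + 1 / 6 * (1 + 5 / 4 ^ r) + 1 / 20 * (4 ^ r - 1 / 4 ^ r) * (1 / n) +
          1 / 12 * (5 * (4 ^ r) ^ 2 / 21 - 7 * 4 ^ r / 10 + 97 / (210 * 4 ^ r)) *
            (1 / (n : ℝ) ^ 2)))
      =O[atTop] fun n : ℕ => 1 / (n : ℝ) ^ 3 := by
  have h_half := isBigO_one_div_sub_sum (1 / 2) 2
  have h_three_halves := isBigO_one_div_sub_sum (3 / 2) 2
  have hq : (4 : ℝ) ^ r ≠ 0 := by positivity
  have h_E := isBigO_expectation_numBranches r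
  generalize (4 : ℝ) ^ r = q at hq h_E ⊢
  set p := singularPoly q with hp
  refine ((h_E.add (h_half.const_mul_left (3 * p.coeff 2 + 15 / 2 * p.coeff 3))).sub
    (h_three_halves.const_mul_left (15 / 2 * p.coeff 3))).congr' ?_ (by rfl)
  filter_upwards [eventually_gt_atTop 0] with n hn
  have hn' : (n : ℝ) ≠ 0 := by exact_mod_cast hn.ne'
  have h_ne := two_mul_natCast_sub_one_ne_zero n
  have h_ne' := two_mul_natCast_sub_three_ne_zero n
  have h_two_inv : 3 / (2 * (n : ℝ) - 1) = 3 / 2 * (1 / (n - 1 / 2)) := by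
    field_simp
  have h_two_inv' : 15 / ((2 * (n : ℝ) - 1) * (2 * n - 3)) =
      15 / 4 * (1 / (n - 3 / 2) - 1 / (n - 1 / 2)) := by
    field_simp
    ring
  rw [h_two_inv, h_two_inv']
  simp only [sum_range_succ, sum_range_zero, hp, coeff_singularPoly_zero, coeff_singularPoly_one,
    coeff_singularPoly_two, coeff_singularPoly_three]
  field_simp
  ring

theorem variance_numBranches_expansion (r : ℕ) :
    (fun n : ℕ => variance n (fun t => (numBranches r t : ℝ)) -
        ((4 ^ r - 1) / (3 * (4 ^ r) ^ 2) * n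
          - (2 * (4 ^ r) ^ 2 - 25 * 4 ^ r + 23) / (90 * (4 ^ r) ^ 2)
          - (13 * (4 ^ r) ^ 3 - 14 * (4 ^ r) ^ 2 + 7 * 4 ^ r - 6) / (420 * (4 ^ r) ^ 2) *
            (1 / n)))
      =O[atTop] fun n : ℕ => 1 / (n : ℝ) ^ 2 := by
  have hq : (4 : ℝ) ^ r ≠ 0 := by positivity
  have h_E := expectation_numBranches_expansion r
  have h_pairs := isBigO_expectation_numBranches_mul_sub_one r
  have h_half := isBigO_one_div_sub_sum (1 / 2) 1
  simp only [variance_eq]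
  generalize (4 : ℝ) ^ r = q at hq h_E h_pairs ⊢
  set d := 1 / 12 * (5 * q ^ 2 / 21 - 7 * q / 10 + 97 / (210 * q)) with hd
  refine ((((h_pairs.add (h_half.const_mul_left (6 * (singularPoly q ^ 2).coeff 3))).add
    (h_E.trans (isBigO_one_div_natCast_pow (by norm_num : 2 ≤ 3)))).sub
    (isBigO_sq_sub h_E)).add ((isBigO_refl _ _).const_mul_left d)).congr' ?_ (by rfl)
  filter_upwards [eventually_gt_atTop 0] with n hn
  have hn' : (n : ℝ) ≠ 0 := by exact_mod_cast hn.ne'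
  have h_ne := two_mul_natCast_sub_one_ne_zero n
  have h_two_inv : 3 / (2 * (n : ℝ) - 1) = 3 / 2 * (1 / (n - 1 / 2)) := by
    field_simp
  rw [h_two_inv]
  simp only [pow_two (singularPoly q), Polynomial.coeff_mul,
    Nat.sum_antidiagonal_eq_sum_range_succ_mk, sum_range_succ, sum_range_zero, zero_add,
    Nat.reduceSub, coeff_singularPoly_zero, coeff_singularPoly_one,
    coeff_singularPoly_two, coeff_singularPoly_three, hd]
  field_simp
  ring

end AsymptoticExpansions

end RBranches

theorem mainTheorem3 (r : ℕ) :
    ((fun n : ℕ =>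
        RBranches.expectation n (fun t => (RBranches.numBranches r t : ℝ)) -
          ((n : ℝ) / 4 ^ r + 1 / 6 * (1 + 5 / 4 ^ r)
            + 1 / (20 * (n : ℝ)) * (4 ^ r - 1 / 4 ^ r)
            + 1 / (12 * (n : ℝ) ^ 2) *
                (5 * 16 ^ r / 21 - 7 * 4 ^ r / 10 + 97 / (210 * 4 ^ r))))
      =O[Filter.atTop] fun n : ℕ => 1 / (n : ℝ) ^ 3) ∧
    ((fun n : ℕ =>
        RBranches.variance n (fun t => (RBranches.numBranches r t : ℝ)) -
          ((4 ^ r - 1) / (3 * 16 ^ r) * (n : ℝ)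
            - (2 * 16 ^ r - 25 * 4 ^ r + 23) / (90 * 16 ^ r)
            - (13 * 64 ^ r - 14 * 16 ^ r + 7 * 4 ^ r - 6) / (420 * 16 ^ r * (n : ℝ))))
      =O[Filter.atTop] fun n : ℕ => 1 / (n : ℝ) ^ 2) := by
  have h_sixteen : (16 : ℝ) ^ r = (4 ^ r) ^ 2 := by rw [pow_right_comm]; norm_num
  have h_sixty_four : (64 : ℝ) ^ r = (4 ^ r) ^ 3 := by rw [pow_right_comm]; norm_num
  refine ⟨(RBranches.expectation_numBranches_expansion r).congr_left fun n => ?_,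
    (RBranches.variance_numBranches_expansion r).congr_left fun n => ?_⟩
  · rw [h_sixteen]
    ring
  · rw [h_sixteen, h_sixty_four]
    ring
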